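/- Let $p,\ell,n,m$ be nonnegative integers with $\ell\le p$, put $I=\{1,\dots,\ell\}$, $J=\{\ell+1,\dots,p\}$, and let $h_1,\dots,h_p\colon\mathbb R^n\times\mathbb R^m\to\overline{\mathbb R}$ be given. Consider the set-valued mapping $$\Gamma(x)=\{y\in\mathbb R^m : h_i(x,y)\le 0\ (i\in I),\ h_i(x,y)=0\ (i\in J)\},\qquad \operatorname{dom}\Gamma=\{x\in\mathbb R^n : \Gamma(x)\neq\varnothing\}.$$ Fix $\bar x\in\mathbb R^n$ and $\bar y\in\Gamma(\bar x)$. Assume that there is an open neighborhood of $\{\bar x\}\times\Gamma(\bar x)$ on which all $h_i$ are real-valued, continuous, and continuously differentiable with respect to $y$ (i.e. $\nabla_yh_i$ exists and is continuous in $(x,y)$), and that, for each $x\in\operatorname{dom}\Gamma$, all functions $h_i(x,\cdot)$ are real-valued and continuous on $\mathbb R^m$. No convexity of the data and no local boundedness of $\Gamma$ is assumed. Suppose that 1. $\Gamma$ is inner semicontinuous at $(\bar x,\bar y)$ with respect to $\operatorname{dom}\Gamma$: for each sequence $(x^k)\subset\operatorname{dom}\Gamma$ with $x^k\to\bar x$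 there is a sequence $y^k\to\bar y$ with $y^k\in\Gamma(x^k)$ for all sufficiently large $k$; 2. the relaxed constant positive linear dependence constraint qualification (RCPLD) holds at $(\bar x,\bar y)$ with respect to $\operatorname{dom}\Gamma$: there are a neighborhood $U$ of $(\bar x,\bar y)$ and an index set $S\subset J$ such that (i) the family $(\nabla_yh_i(\bar x,\bar y))_{i\in S}$ is a basis of the span of $\{\nabla_yh_i(\bar x,\bar y) : i\in J\}$; (ii) the family $(\nabla_yh_i(x,y))_{i\in J}$ has constant rank on $U\cap(\operatorname{dom}\Gamma\times\mathbb R^m)$; (iii) for each $K\subset\{i\in I : h_i(\bar x,\bar y)=0\}$ for which there are $\alpha_i\ge0$ $(i\in K)$ and $\beta_i\in\mathbb R$ $(i\in S)$, not all zero, with $\sum_{i\in K}\alpha_i\nabla_yh_i(\bar x,\bar y)+\sum_{i\in S}\beta_i\nabla_yh_i(\bar x,\bar y)=0$, the family $(\nabla_yh_i(x,y))_{i\in K\cup S}$ is linearly dependent for each $(x,y)\in U\cap(\operatorname{dom}\Gamma\times\mathbb R^m)$. Then $\Gamma$ is R-regular at $(\bar x,\bar y)$ with respect to $\operatorname{dom}\Gamma$: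 there are $\kappa>0$ and a neighborhood $V$ of $(\bar x,\bar y)$ such that, for all $(x,y)\in V$ with $x\in\operatorname{dom}\Gamma$, $$\operatorname{dist}(y,\Gamma(x))\le\kappa\,\max\bigl\{0,\ \max_{i\in I}h_i(x,y),\ \max_{i\in J}|h_i(x,y)|\bigr\},$$ where maxima over empty index sets are omitted. -/

import Mathlib

open scoped Topology

noncomputable section

namespace ParamSystem

/-- The Euclidean space `ℝᵈ` (with the Euclidean norm). -/
abbrev E (d : ℕ) : Type := EuclideanSpace ℝ (Fin d)

/-- Indices of the inequality constraints: the first `ℓ` of the `p` indices. -/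
def ineqIdx (p ℓ : ℕ) : Finset (Fin p) := Finset.univ.filter fun i => (i : ℕ) < ℓ

/-- Indices of the equality constraints: the remaining `p - ℓ` indices. -/
def eqIdx (p ℓ : ℕ) : Finset (Fin p) := Finset.univ.filter fun i => ℓ ≤ (i : ℕ)

variable {n m p : ℕ}

/-- Domain of a set-valued mapping. -/
def dom (Υ : E n → Set (E m)) : Set (E n) := {x | (Υ x).Nonempty}

/-- The set-valued mapping
`Γ(x) = {y | h_i(x,y) ≤ 0 for i ∈ I, h_i(x,y) = 0 for i ∈ J}`
given by extended-real-valued data functions. -/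
def feas (ℓ : ℕ) (h : Fin p → E n → E m → EReal) (x : E n) : Set (E m) :=
  {y | (∀ i ∈ ineqIdx p ℓ, h i x y ≤ 0) ∧ (∀ i ∈ eqIdx p ℓ, h i x y = 0)}

/-- The partial gradient `∇_y h_i(x,y)`. It is only meaningful where `h_i(x,·)` is finite around
`y` and differentiable at `y`. -/
def gradY (h : Fin p → E n → E m → EReal) (i : Fin p) (x : E n) (y : E m) : E m :=
  gradient (fun y' : E m => (h i x y').toReal) y

/-- On the (open) set `W`, all functions `h_i` are real-valued, continuous, and continuously
differentiable with respect to `y`: the partial gradients `∇_y h_i` exist and depend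
continuously on `(x,y)`. -/
def SmoothOn (h : Fin p → E n → E m → EReal) (W : Set (E n × E m)) : Prop :=
  ∀ i : Fin p,
    (∀ z ∈ W, h i z.1 z.2 ≠ ⊤ ∧ h i z.1 z.2 ≠ ⊥) ∧
    ContinuousOn (fun z : E n × E m => h i z.1 z.2) W ∧
    (∀ z ∈ W, DifferentiableAt ℝ (fun y : E m => (h i z.1 y).toReal) z.2) ∧
    ContinuousOn (fun z : E n × E m => gradY h i z.1 z.2) W

/-- The indices of the inequality constraints which are active at `(x,y)`. -/
def activeIdx (ℓ : ℕ) (h : Fin p → E n → E m → EReal) (x : E n) (y : E m) : Set (Fin p) :=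
  {i | i ∈ ineqIdx p ℓ ∧ h i x y = 0}

/-- Positive-linear dependence of a pair of finite families of vectors. -/
def PosLinDep {ι₁ ι₂ V : Type*} [Fintype ι₁] [Fintype ι₂] [AddCommGroup V] [Module ℝ V]
    (a : ι₁ → V) (b : ι₂ → V) : Prop :=
  ∃ (α : ι₁ → ℝ) (β : ι₂ → ℝ),
    (∀ i, 0 ≤ α i) ∧ ((∃ i, α i ≠ 0) ∨ (∃ i, β i ≠ 0)) ∧
      ∑ i, α i • a i + ∑ i, β i • b i = 0

/-- The rank of a family of vectors. -/
def famRank {ι V : Type*} [AddCommGroup V] [Module ℝ V] (v : ι → V) : ℕ :=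
  Module.finrank ℝ (Submodule.span ℝ (Set.range v))

/-- The relaxed constant positive linear dependence constraint qualification at `(xb,yb)`
with respect to `Ω`. Condition (i), that the gradients with index in `S` form a basis of the span
of those with index in `J`, is read for families: the family indexed by `S` is linearly
independent and spans the same subspace. -/
def RCPLD (ℓ : ℕ) (h : Fin p → E n → E m → EReal) (Ω : Set (E n)) (xb : E n) (yb : E m) : Prop :=
  ∃ U ∈ 𝓝 (xb, yb), ∃ S : Finset (Fin p), S ⊆ eqIdx p ℓ ∧
    (LinearIndependent ℝ (fun i : S => gradY h i xb yb) ∧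
      Submodule.span ℝ (Set.range fun i : S => gradY h i xb yb) =
        Submodule.span ℝ (Set.range fun i : eqIdx p ℓ => gradY h i xb yb)) ∧
    (∃ r : ℕ, ∀ z ∈ U ∩ (Ω ×ˢ Set.univ),
      famRank (fun i : eqIdx p ℓ => gradY h i z.1 z.2) = r) ∧
    (∀ K : Finset (Fin p), (∀ i ∈ K, i ∈ activeIdx ℓ h xb yb) →
      PosLinDep (fun i : K => gradY h i xb yb) (fun i : S => gradY h i xb yb) →
      ∀ z ∈ U ∩ (Ω ×ˢ Set.univ),
        ¬ LinearIndependent ℝ (fun i : (K ∪ S : Finset (Fin p)) => gradY h i z.1 z.2))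

/-- Inner semicontinuity of a set-valued mapping at a point `(xb,yb)` of its graph
with respect to `Ω`. -/
def InnerSemicontinuousAt (Υ : E n → Set (E m)) (Ω : Set (E n)) (xb : E n) (yb : E m) : Prop :=
  yb ∈ Υ xb ∧
    ∀ x : ℕ → E n, (∀ k, x k ∈ Ω) → Filter.Tendsto x Filter.atTop (𝓝 xb) →
      ∃ y : ℕ → E m, Filter.Tendsto y Filter.atTop (𝓝 yb) ∧
        ∀ᶠ k in Filter.atTop, y k ∈ Υ (x k)

/-- The constraint violation
`max {0, max {h_i(x,y) | i ∈ I}, max {|h_i(x,y)| | i ∈ J}}`;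
a maximum over an empty index set is `-∞` and thus does not contribute. -/
def violation (ℓ : ℕ) (h : Fin p → E n → E m → EReal) (x : E n) (y : E m) : EReal :=
  max 0 (max (⨆ i ∈ ineqIdx p ℓ, h i x y) (⨆ i ∈ eqIdx p ℓ, ((h i x y).abs : EReal)))

/-- R-regularity of `Γ` at a point `(xb,yb)` of its graph with respect to `Ω`. The distance is
taken in `[0,∞]`, so that the distance to the empty set is `∞`. -/
def RRegularAt (ℓ : ℕ) (h : Fin p → E n → E m → EReal) (Ω : Set (E n)) (xb : E n) (yb : E m) :
    Prop :=
  yb ∈ feas ℓ h xb ∧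
    ∃ κ : ℝ, 0 < κ ∧ ∃ U ∈ 𝓝 (xb, yb), ∀ z ∈ U ∩ (Ω ×ˢ Set.univ),
      ((Metric.infEDist z.2 (feas ℓ h z.1) : ENNReal) : EReal) ≤
        (κ : EReal) * violation ℓ h z.1 z.2

end ParamSystem

end

namespace ParamSystem

/-! The distance to `Γ(x)` is estimated by a quadratic penalty method. Minimize the squared distance
to `y` plus a large multiple of the squared violation, over a ball around `y` whose interior
contains a feasible point; inner semicontinuity supplies that point. The minimizer `u` is interior
and almost feasible, and stationarity writes `y - u` as a combination of constraint gradients at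
`u`, with nonnegative weights on the violated inequalities and zero weights on the other
inequalities.

These weights may blow up with the penalty parameter. RCPLD allows them to be replaced by weights of
size at most `C * ‖y - u‖` with the same sum (`RCPLD.exists_bounded_multipliers`). Pairing that sum
with `y - u` and linearizing each constraint gives `‖y - u‖² ≤ p C ‖y - u‖ (t + ε ‖y - u‖ + δ)`,
where `t` bounds the violation at `y`. For small `ε` this forces `‖y - u‖ ≤ 2 p C (t + δ)`, which
contradicts any larger distance to `Γ(x)` (`infDist_le_of_bounded_multipliers`). -/

/-! ### Linear algebra of multipliers -/

/-- By compactness of the unit sphere in the cone, the combination at `z₀` has norm at least `η *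
‖c‖`; a perturbation of the vectors of total size below `η / 2` costs at most half of this. -/
theorem eventually_norm_le_of_injOn_cone {ι Z V : Type*} [Fintype ι] [TopologicalSpace Z]
    [NormedAddCommGroup V] [NormedSpace ℝ V] (v : Z → ι → V) (z₀ : Z)
    (hv : ∀ i, ContinuousAt (fun z => v z i) z₀) (T : Set (ι → ℝ)) (hT : IsClosed T)
    (hsmul : ∀ c ∈ T, ∀ s : ℝ, 0 < s → s • c ∈ T)
    (hinj : ∀ c ∈ T, ∑ i, c i • v z₀ i = 0 → c = 0) :
    ∃ C : ℝ, 0 < C ∧ ∀ᶠ z in 𝓝 z₀, ∀ c ∈ T, ‖c‖ ≤ C * ‖∑ i, c i • v z i‖ := by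
  obtain ⟨η, hη, hmin⟩ : ∃ η : ℝ, 0 < η ∧ ∀ c ∈ T, ‖c‖ = 1 → η ≤ ‖∑ i, c i • v z₀ i‖ := by
    have hK : IsCompact (T ∩ Metric.sphere (0 : ι → ℝ) 1) :=
      (isCompact_sphere 0 1).inter_left hT
    rcases (T ∩ Metric.sphere (0 : ι → ℝ) 1).eq_empty_or_nonempty with he | hne
    · refine ⟨1, one_pos, fun c hc h1 => ?_⟩
      have : c ∈ T ∩ Metric.sphere (0 : ι → ℝ) 1 := ⟨hc, by simpa using h1⟩
      simp [he] at this
    · obtain ⟨c₀, hc₀, hm⟩ := hK.exists_isMinOn hne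
        (f := fun c : ι → ℝ => ‖∑ i, c i • v z₀ i‖) (by fun_prop)
      refine ⟨‖∑ i, c₀ i • v z₀ i‖, norm_pos_iff.2 fun h0 => ?_, fun c hc h1 => ?_⟩
      · have := hc₀.2
        simp [hinj c₀ hc₀.1 h0] at this
      · exact hm ⟨hc, by simpa using h1⟩
  have hclose : ∀ᶠ z in 𝓝 z₀, ∑ i, ‖v z i - v z₀ i‖ < η / 2 := by
    have : ContinuousAt (fun z => ∑ i, ‖v z i - v z₀ i‖) z₀ :=
      tendsto_finsetSum _ fun i _ => ((hv i).sub continuousAt_const).norm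
    refine this.eventually_lt continuousAt_const ?_
    simpa using by positivity
  refine ⟨2 / η, by positivity, hclose.mono fun z hz c hc => ?_⟩
  rcases eq_or_ne c 0 with rfl | hc0
  · simp
  have hn : 0 < ‖c‖ := norm_pos_iff.2 hc0
  have h1 : η * ‖c‖ ≤ ‖∑ i, c i • v z₀ i‖ := by
    have := hmin _ (hsmul c hc ‖c‖⁻¹ (by positivity))
      (by rw [norm_smul, norm_inv, norm_norm, inv_mul_cancel₀ hn.ne'])
    simp only [Pi.smul_apply, smul_assoc, ← Finset.smul_sum] at this
    rw [norm_smul, norm_inv, norm_norm, inv_mul_eq_div, le_div_iff₀ hn] at this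
    exact this
  have h2 : ‖∑ i, c i • v z i - ∑ i, c i • v z₀ i‖ ≤ ‖c‖ * (η / 2) := by
    rw [← Finset.sum_sub_distrib]
    refine (norm_sum_le _ _).trans ?_
    refine le_trans ?_ (mul_le_mul_of_nonneg_left hz.le hn.le)
    rw [Finset.mul_sum]
    refine Finset.sum_le_sum fun i _ => ?_
    rw [← smul_sub, norm_smul]
    exact mul_le_mul_of_nonneg_right (norm_le_pi_norm c i) (norm_nonneg _)
  have h3 := norm_sub_norm_le (∑ i, c i • v z₀ i) (∑ i, c i • v z i)
  rw [norm_sub_rev] at h3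
  rw [div_mul_eq_mul_div, le_div_iff₀ hη]
  linarith

/-- Carathéodory reduction that keeps all of `S`: while a dependence remains, it is used to remove
an index of `K`, which is possible because `S` alone is independent. -/
theorem exists_linearIndepOn_nonneg_combination {ι V : Type*} [Fintype ι] [DecidableEq ι]
    [AddCommGroup V] [Module ℝ V] (v : ι → V) (S : Finset ι)
    (hS : LinearIndependent ℝ fun i : S => v i) (K : Finset ι) (hKS : Disjoint K S) (c : ι → ℝ)
    (hc : ∀ i ∈ K, 0 ≤ c i) (hsupp : ∀ i, i ∉ K ∪ S → c i = 0) :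
    ∃ K' ⊆ K, ∃ c' : ι → ℝ, (∀ i ∈ K', 0 ≤ c' i) ∧ (∀ i, i ∉ K' ∪ S → c' i = 0) ∧
      ∑ i, c' i • v i = ∑ i, c i • v i ∧
      LinearIndependent ℝ fun i : (K' ∪ S : Finset ι) => v i := by
  induction hk : K.card using Nat.strong_induction_on generalizing K c with
  | _ k ih =>
  by_cases hli : LinearIndependent ℝ fun i : (K ∪ S : Finset ι) => v i
  · exact ⟨K, subset_rfl, c, hc, hsupp, rfl, hli⟩
  obtain ⟨g, hg0, hgsum, i₀, hi₀K, hi₀⟩ : ∃ g : ι → ℝ, (∀ i, i ∉ K ∪ S → g i = 0) ∧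
      ∑ i, g i • v i = 0 ∧ ∃ i ∈ K, 0 < g i := by
    have hli' : ¬ LinearIndepOn ℝ v ((K ∪ S : Finset ι) : Set ι) := hli
    rw [linearIndepOn_finset_iff] at hli'
    push Not at hli'
    obtain ⟨g, hg, j, hj, hgj⟩ := hli'
    obtain ⟨i, hiK, hi⟩ : ∃ i ∈ K, g i ≠ 0 := by
      by_contra! hno
      have hS' : LinearIndepOn ℝ v (S : Set ι) := hS
      rw [linearIndepOn_finset_iff] at hS'
      have := hS' g (by
        rw [Finset.sum_union hKS, Finset.sum_eq_zero fun i hi => by rw [hno i hi, zero_smul],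
          zero_add] at hg
        exact hg)
      rcases Finset.mem_union.1 hj with h | h
      · exact hgj (hno j h)
      · exact hgj (this j h)
    let G : ι → ℝ := fun i => if i ∈ K ∪ S then g i else 0
    have hG : ∑ i, G i • v i = 0 := by
      simp only [G, ite_smul, zero_smul]
      rwa [Finset.sum_ite_mem, Finset.univ_inter]
    have hGi : G i = g i := by simp [G, hiK]
    rcases lt_or_gt_of_ne hi with h | h
    · refine ⟨-G, fun j hj => by simp only [Pi.neg_apply, G, if_neg hj, neg_zero], ?_, i, hiK, ?_⟩
      · simp [hG]
      · simpa [hGi] using h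
    · exact ⟨G, fun j hj => by simp only [G, if_neg hj], hG, i, hiK, by rwa [hGi]⟩
  -- Ratio test: subtracting `c q / g q` times the dependence kills the coefficient at `q` and, by
  -- minimality of the ratio, keeps the others on `K` nonnegative.
  obtain ⟨q, hq, hmin⟩ := (K.filter fun i => 0 < g i).exists_min_image (fun i => c i / g i)
    ⟨i₀, by simp [hi₀K, hi₀]⟩
  rw [Finset.mem_filter] at hq
  obtain ⟨hqK, hgq⟩ := hq
  have hcard := Finset.card_erase_lt_of_mem hqK
  have hnn : ∀ i ∈ K.erase q, 0 ≤ c i - c q / g q * g i := by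
    intro i hi
    have hiK := Finset.mem_of_mem_erase hi
    have hr : 0 ≤ c q / g q := div_nonneg (hc q hqK) hgq.le
    rcases le_or_gt (g i) 0 with hgi | hgi
    · have := mul_nonpos_of_nonneg_of_nonpos hr hgi
      have := hc i hiK
      linarith
    · have := hmin i (by simp [hiK, hgi])
      rw [le_div_iff₀ hgi] at this
      linarith
  have hsupp' : ∀ i, i ∉ K.erase q ∪ S → c i - c q / g q * g i = 0 := by
    intro i hi
    rcases eq_or_ne i q with rfl | hiq
    · rw [div_mul_cancel₀ _ hgq.ne', sub_self]
    · have : i ∉ K ∪ S := by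
        simp only [Finset.mem_union, Finset.mem_erase] at hi ⊢
        tauto
      simp [hsupp i this, hg0 i this]
  obtain ⟨K', hK', c', h1, h2, h3, h4⟩ := ih _ (hk ▸ hcard) (K.erase q)
    (hKS.mono_left (Finset.erase_subset _ _)) (fun i => c i - c q / g q * g i) hnn hsupp' rfl
  refine ⟨K', hK'.trans (Finset.erase_subset _ _), c', h1, h2, ?_, h4⟩
  rw [h3]
  simp only [sub_smul, Finset.sum_sub_distrib, mul_smul, ← Finset.smul_sum, hgsum, smul_zero,
    sub_zero]

/-! ### Penalty method and error bound -/

theorem hasDerivAt_max_zero_sq (t : ℝ) :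
    HasDerivAt (fun s : ℝ => max s 0 ^ 2) (2 * max t 0) t := by
  rw [hasDerivAt_iff_isLittleO]
  have h : (fun s : ℝ => max s 0 ^ 2 - max t 0 ^ 2 - (s - t) • (2 * max t 0))
      =O[𝓝 t] fun s => (s - t) ^ 2 := by
    refine Asymptotics.IsBigO.of_bound 1 (Filter.Eventually.of_forall fun s => ?_)
    rw [Real.norm_eq_abs, Real.norm_eq_abs, abs_of_nonneg (sq_nonneg (s - t)), one_mul, smul_eq_mul,
      abs_le]
    rcases le_total s 0 with hs | hs <;> rcases le_total t 0 with ht | ht <;>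
      simp only [max_eq_left, max_eq_right, hs, ht] <;> constructor <;> nlinarith
  refine h.trans_isLittleO ?_
  have h' : Filter.Tendsto (fun s : ℝ => s - t) (𝓝 t) (𝓝 0) := by
    simpa using (by fun_prop : Continuous fun s : ℝ => s - t).tendsto t
  simpa [Function.comp_def] using
    (Asymptotics.isLittleO_pow_id (𝕜 := ℝ) one_lt_two).comp_tendsto h'

theorem penalty_stationary {ι V : Type*} [Fintype ι] [DecidableEq ι] [NormedAddCommGroup V]
    [InnerProductSpace ℝ V] [CompleteSpace V] (f : ι → V → ℝ) (g : ι → V) (I : Finset ι)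
    (y u : V) (j : ℝ) (hf : ∀ i, HasGradientAt (f i) (g i) u)
    (hmin : IsLocalMin (fun u => ‖u - y‖ ^ 2 +
      j * ∑ i, if i ∈ I then max (f i u) 0 ^ 2 else f i u ^ 2) u) :
    y - u = ∑ i, (j * if i ∈ I then max (f i u) 0 else f i u) • g i := by
  have hd : ∀ i, HasFDerivAt (fun u => if i ∈ I then max (f i u) 0 ^ 2 else f i u ^ 2)
      ((2 * if i ∈ I then max (f i u) 0 else f i u) • innerSL ℝ (g i)) u := by
    intro i
    have hfi : HasFDerivAt (f i) (innerSL ℝ (g i)) u := (hf i).hasFDerivAt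
    split_ifs with hi
    · exact (hasDerivAt_max_zero_sq (f i u)).comp_hasFDerivAt u hfi
    · have h2 : HasDerivAt (fun s : ℝ => s ^ 2) (2 * f i u) (f i u) := by
        simpa using hasDerivAt_pow 2 (f i u)
      exact h2.comp_hasFDerivAt u hfi
  have hn : HasFDerivAt (fun u => ‖u - y‖ ^ 2) (2 • innerSL ℝ (u - y)) u := by
    simpa using ((hasFDerivAt_id u).sub_const y).norm_sq
  have h0 := hmin.hasFDerivAt_eq_zero
    (hn.add ((HasFDerivAt.fun_sum fun i (_ : i ∈ Finset.univ) => hd i).const_mul j))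
  refine ext_inner_right ℝ fun w => ?_
  have := congrArg (fun L => L w) h0
  simp only [_root_.add_apply, _root_.smul_apply,
    _root_.sum_apply, innerSL_apply_apply, _root_.zero_apply,
    smul_eq_mul, nsmul_eq_mul, Nat.cast_ofNat, mul_assoc, ← Finset.mul_sum] at this
  simp only [sum_inner, real_inner_smul_left, mul_assoc, ← Finset.mul_sum]
  rw [inner_sub_left] at this ⊢
  linarith

/-- A local error bound for a system of inequalities and equalities under an abstract bound on
the multipliers. -/
theorem infDist_le_of_bounded_multipliers {ι V : Type*} [Fintype ι] [DecidableEq ι]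
    [NormedAddCommGroup V] [InnerProductSpace ℝ V] [FiniteDimensional ℝ V]
    (f : ι → V → ℝ) (g : ι → V → V) (I : Finset ι) (F B : Set V) (ε C t r : ℝ) (y w : V)
    (hF : ∀ u ∈ B, (∀ i ∈ I, f i u ≤ 0) → (∀ i ∉ I, f i u = 0) → u ∈ F)
    (hf : ∀ i, ∀ u ∈ B, HasGradientAt (f i) (g i u) u)
    (hlin : ∀ i, ∀ u ∈ B, |f i y - f i u - inner ℝ (g i u) (y - u)| ≤ ε * ‖y - u‖)
    (hmult : ∀ u ∈ B, ∀ c : ι → ℝ, (∀ i ∈ I, 0 ≤ c i) → (∀ i ∈ I, f i u ≤ 0 → c i = 0) →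
      ∃ c' : ι → ℝ, (∀ i ∈ I, 0 ≤ c' i) ∧ (∀ i ∈ I, f i u ≤ 0 → c' i = 0) ∧
        ∑ i, c' i • g i u = ∑ i, c i • g i u ∧ ‖c'‖ ≤ C * ‖∑ i, c i • g i u‖)
    (hε : 0 ≤ ε) (hC : 0 ≤ C) (hεC : Fintype.card ι * C * ε ≤ 1 / 2) (ht : 0 ≤ t)
    (htI : ∀ i ∈ I, f i y ≤ t) (htJ : ∀ i ∉ I, |f i y| ≤ t)
    (hB : Metric.closedBall y r ⊆ B) (hwr : dist w y < r) (hwF : w ∈ F)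
    (hwI : ∀ i ∈ I, f i w ≤ 0) (hwJ : ∀ i ∉ I, f i w = 0) :
    Metric.infDist y F ≤ 2 * Fintype.card ι * C * t := by
  have : CompleteSpace V := FiniteDimensional.complete ℝ V
  have : ProperSpace V := FiniteDimensional.proper ℝ V
  have hr : 0 < r := dist_nonneg.trans_lt hwr
  set N : ℝ := (Fintype.card ι : ℝ) with hN
  have hN0 : 0 ≤ N := Nat.cast_nonneg _
  set P : V → ℝ := fun u => ∑ i, if i ∈ I then max (f i u) 0 ^ 2 else f i u ^ 2 with hP
  have hPnn : ∀ u i, 0 ≤ (if i ∈ I then max (f i u) 0 ^ 2 else f i u ^ 2) := by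
    intro u i; split_ifs <;> positivity
  have hP0 : ∀ u, 0 ≤ P u := fun u => Finset.sum_nonneg fun i _ => hPnn u i
  have hPw : P w = 0 := Finset.sum_eq_zero fun i _ => by
    split_ifs with hi
    · simp [max_eq_right (hwI i hi)]
    · simp [hwJ i hi]
  have hfc : ∀ i, ContinuousOn (f i) (Metric.closedBall y r) := fun i u hu =>
    (hf i u (hB hu)).continuousAt.continuousWithinAt
  have hPc : ContinuousOn P (Metric.closedBall y r) := by
    refine continuousOn_finsetSum _ fun i _ => ?_
    split_ifs
    · exact (ContinuousOn.sup (hfc i) continuousOn_const).pow 2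
    · exact (hfc i).pow 2
  by_contra! hlt
  obtain ⟨d, hd1, hd2⟩ := exists_between hlt
  have hd0 : 0 ≤ d := le_trans (by positivity) hd1.le
  have hdr : d < r := by
    have := Metric.infDist_le_dist_of_mem (x := y) hwF
    rw [dist_comm] at this
    linarith
  -- The ball of radius `d` contains no feasible point, since `d` is below the distance to `F`; so
  -- the violation `P` is bounded away from zero on it.
  obtain ⟨η, hη, hPη⟩ : ∃ η : ℝ, 0 < η ∧ ∀ u ∈ Metric.closedBall y d, η ≤ P u := by
    have hsub : Metric.closedBall y d ⊆ Metric.closedBall y r :=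
      Metric.closedBall_subset_closedBall hdr.le
    obtain ⟨u₀, hu₀, hm⟩ := (isCompact_closedBall y d).exists_isMinOn
      ⟨y, Metric.mem_closedBall_self hd0⟩ (hPc.mono hsub)
    refine ⟨P u₀, lt_of_le_of_ne (hP0 _) fun h0 => ?_, fun u hu => hm hu⟩
    have hz := (Finset.sum_eq_zero_iff_of_nonneg fun i _ => hPnn u₀ i).1 h0.symm
    have hu₀F : u₀ ∈ F := by
      refine hF u₀ (hB (hsub hu₀)) (fun i hi => ?_) fun i hi => ?_
      · have := hz i (Finset.mem_univ i)
        rw [if_pos hi] at this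
        exact max_eq_right_iff.1 (pow_eq_zero_iff two_ne_zero |>.1 this)
      · have := hz i (Finset.mem_univ i)
        rw [if_neg hi] at this
        exact pow_eq_zero_iff two_ne_zero |>.1 this
    have := Metric.infDist_le_dist_of_mem (x := y) hu₀F
    rw [dist_comm] at this
    linarith [Metric.mem_closedBall.1 hu₀]
  obtain ⟨δ, hδ, hδη, hδd⟩ : ∃ δ : ℝ, 0 < δ ∧ δ ^ 2 < η ∧ 2 * N * C * (t + δ) ≤ d := by
    have h1 : ∀ᶠ δ in 𝓝 (0 : ℝ), δ ^ 2 < η :=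
      (continuous_pow 2).continuousAt.eventually_lt continuousAt_const (by simpa using hη)
    have h2 : ∀ᶠ δ in 𝓝 (0 : ℝ), 2 * N * C * (t + δ) < d :=
      (by fun_prop : Continuous fun δ => 2 * N * C * (t + δ)).continuousAt.eventually_lt
        continuousAt_const (by simpa using hd1)
    obtain ⟨δ, ⟨ha, hb⟩, hc⟩ := (((h1.and h2).filter_mono nhdsWithin_le_nhds).and
      (self_mem_nhdsWithin (s := Set.Ioi (0 : ℝ)))).exists
    exact ⟨δ, hc, ha, hb.le⟩
  -- Comparison with the feasible `w` gives `j * P u ≤ r ^ 2`, so this weight yields `P u ≤ δ ^ 2 <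
  -- η` at the minimizer.
  set j : ℝ := (r / δ) ^ 2 with hj
  have hj0 : 0 < j := by positivity
  have hφc : ContinuousOn (fun u => ‖u - y‖ ^ 2 + j * P u) (Metric.closedBall y r) :=
    (by fun_prop : Continuous fun u : V => ‖u - y‖ ^ 2).continuousOn.add (hPc.const_smul j)
  obtain ⟨u, hu, hmin⟩ := (isCompact_closedBall y r).exists_isMinOn
    ⟨y, Metric.mem_closedBall_self hr.le⟩ hφc
  have huw : ‖u - y‖ ^ 2 + j * P u ≤ ‖w - y‖ ^ 2 := by
    have : ‖u - y‖ ^ 2 + j * P u ≤ ‖w - y‖ ^ 2 + j * P w := hmin (Metric.mem_closedBall.2 hwr.le)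
    simpa [hPw] using this
  rw [dist_eq_norm] at hwr
  have hur : ‖u - y‖ < r := by
    have h1 : ‖u - y‖ ^ 2 ≤ ‖w - y‖ ^ 2 := by
      have := mul_nonneg hj0.le (hP0 u)
      linarith
    exact (pow_le_pow_iff_left₀ (norm_nonneg _) (norm_nonneg _) two_ne_zero |>.1 h1).trans_lt hwr
  have hPu : P u ≤ δ ^ 2 := by
    have h1 : j * P u ≤ r ^ 2 := by
      have := pow_le_pow_left₀ (norm_nonneg _) hwr.le 2
      have := sq_nonneg ‖u - y‖
      linarith
    rw [hj, div_pow, div_mul_eq_mul_div, div_le_iff₀ (by positivity)] at h1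
    exact le_of_mul_le_mul_left h1 (by positivity)
  have hloc : IsLocalMin (fun u => ‖u - y‖ ^ 2 + j * P u) u :=
    hmin.isLocalMin (Metric.closedBall_mem_nhds_of_mem (by simpa [dist_eq_norm] using hur))
  have huB := hB hu
  have hst := penalty_stationary f (fun i => g i u) I y u j (fun i => hf i u huB) hloc
  obtain ⟨c, hc0, hcz, hcs, hcn⟩ := hmult u huB
    (fun i => j * if i ∈ I then max (f i u) 0 else f i u)
    (fun i hi => by rw [if_pos hi]; positivity)
    (fun i hi h0 => by rw [if_pos hi, max_eq_right h0, mul_zero])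
  rw [← hst] at hcs hcn
  set v := y - u with hv
  -- Only inequalities violated at `u` carry weight, so there `-f i u` can be dropped; for
  -- equalities, `|f i u| ≤ δ` since `P u ≤ δ ^ 2`.
  have hterm : ∀ i, c i * inner ℝ (g i u) v ≤ C * ‖v‖ * (t + ε * ‖v‖ + δ) := by
    intro i
    have hb : 0 ≤ t + ε * ‖v‖ + δ := by positivity
    have hci : |c i| ≤ C * ‖v‖ := (norm_le_pi_norm c i).trans hcn
    have hl := abs_le.1 (hlin i u huB)
    by_cases hi : i ∈ I
    · rcases le_or_gt (f i u) 0 with h0 | h0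
      · rw [hcz i hi h0, zero_mul]; positivity
      · have : inner ℝ (g i u) v ≤ t + ε * ‖v‖ + δ := by
          have := htI i hi
          linarith [hl.1]
        refine (mul_le_mul_of_nonneg_left this (hc0 i hi)).trans ?_
        exact mul_le_mul_of_nonneg_right ((le_abs_self _).trans hci) hb
    · have hfu : |f i u| ≤ δ := by
        have h1 : f i u ^ 2 ≤ P u := by
          have := Finset.single_le_sum (fun i _ => hPnn u i) (Finset.mem_univ i)
          rwa [if_neg hi] at this
        exact abs_le_of_sq_le_sq (h1.trans hPu) hδ.le
      have h2 : |inner ℝ (g i u) v| ≤ t + ε * ‖v‖ + δ := by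
        have h3 := abs_le.1 (htJ i hi)
        have h4 := abs_le.1 hfu
        exact abs_le.2 ⟨by linarith [hl.2], by linarith [hl.1]⟩
      calc c i * inner ℝ (g i u) v ≤ |c i| * |inner ℝ (g i u) v| := by
            rw [← abs_mul]; exact le_abs_self _
        _ ≤ _ := mul_le_mul hci h2 (abs_nonneg _) (by positivity)
  have hvv : ‖v‖ ^ 2 ≤ N * (C * ‖v‖ * (t + ε * ‖v‖ + δ)) := by
    calc ‖v‖ ^ 2 = inner ℝ (∑ i, c i • g i u) v := by rw [hcs, real_inner_self_eq_norm_sq]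
      _ = ∑ i, c i * inner ℝ (g i u) v := by simp only [sum_inner, real_inner_smul_left]
      _ ≤ ∑ _i : ι, C * ‖v‖ * (t + ε * ‖v‖ + δ) := Finset.sum_le_sum fun i _ => hterm i
      _ = _ := by simp [hN]
  -- `P u < η` keeps `u` outside the ball of radius `d`, whereas the multiplier estimate will give
  -- `‖v‖ ≤ 2 * N * C * (t + δ) ≤ d`.
  have hvd : d < ‖v‖ := by
    by_contra! hle
    have := hPη u (by rwa [Metric.mem_closedBall, dist_comm, dist_eq_norm])
    linarith
  have hv0 : 0 < ‖v‖ := hd0.trans_lt hvd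
  have h5 : ‖v‖ ≤ N * C * (t + ε * ‖v‖ + δ) := by
    refine le_of_mul_le_mul_right ?_ hv0
    linarith
  have h6 : N * C * ε * ‖v‖ ≤ 1 / 2 * ‖v‖ := mul_le_mul_of_nonneg_right hεC hv0.le
  linarith

/-! ### Bounded multipliers from RCPLD -/

theorem mem_eqIdx_iff {p ℓ : ℕ} {i : Fin p} : i ∈ eqIdx p ℓ ↔ i ∉ ineqIdx p ℓ := by
  simp [eqIdx, ineqIdx]

theorem eq_zero_of_not_posLinDep {ι V : Type*} [Fintype ι] [DecidableEq ι] [AddCommGroup V]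
    [Module ℝ V] (v : ι → V) (K S : Finset ι) (hKS : Disjoint K S)
    (hdep : ¬ PosLinDep (fun i : K => v i) (fun i : S => v i)) (c : ι → ℝ)
    (hc : ∀ i ∈ K, 0 ≤ c i) (hsupp : ∀ i, i ∉ K ∪ S → c i = 0) (hsum : ∑ i, c i • v i = 0) :
    c = 0 := by
  by_contra hne
  obtain ⟨i, hi⟩ := Function.ne_iff.1 hne
  refine hdep ⟨fun i => c i, fun i => c i, fun i => hc i i.2, ?_, ?_⟩
  · rcases Finset.mem_union.1 (not_imp_comm.1 (hsupp i) hi) with h | h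
    · exact Or.inl ⟨⟨i, h⟩, hi⟩
    · exact Or.inr ⟨⟨i, h⟩, hi⟩
  · rw [Finset.sum_coe_sort K fun i => c i • v i, Finset.sum_coe_sort S fun i => c i • v i,
      ← Finset.sum_union hKS, ← hsum]
    exact Finset.sum_subset (Finset.subset_univ _) fun i _ hi => by rw [hsupp i hi, zero_smul]

/-- Independence of the `S`-gradients persists nearby, and constant rank keeps the dimension of the
full equality span at `S.card`; one span contains the other, so they agree. -/
theorem RCPLD.eventually_span_eq {n m p ℓ : ℕ} {h : Fin p → E n → E m → EReal} {Ω : Set (E n)}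
    {xb : E n} {yb : E m} (hxb : xb ∈ Ω)
    (hg : ∀ i, ContinuousAt (fun z : E n × E m => gradY h i z.1 z.2) (xb, yb))
    {U : Set (E n × E m)} (hU : U ∈ 𝓝 (xb, yb)) {S : Finset (Fin p)} (hSJ : S ⊆ eqIdx p ℓ)
    (hli : LinearIndependent ℝ (fun i : S => gradY h i xb yb))
    (hspan : Submodule.span ℝ (Set.range fun i : S => gradY h i xb yb) =
      Submodule.span ℝ (Set.range fun i : eqIdx p ℓ => gradY h i xb yb))
    {r : ℕ} (hr : ∀ z ∈ U ∩ (Ω ×ˢ Set.univ),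
      famRank (fun i : eqIdx p ℓ => gradY h i z.1 z.2) = r) :
    ∀ᶠ z in 𝓝 (xb, yb), z.1 ∈ Ω → LinearIndependent ℝ (fun i : S => gradY h i z.1 z.2) ∧
      Submodule.span ℝ (Set.range fun i : S => gradY h i z.1 z.2) =
        Submodule.span ℝ (Set.range fun i : eqIdx p ℓ => gradY h i z.1 z.2) := by
  have hr0 : S.card = r := by
    rw [← hr (xb, yb) ⟨mem_of_mem_nhds hU, hxb, trivial⟩, famRank, ← hspan,
      finrank_span_eq_card hli, Fintype.card_coe]
  have hcont : ContinuousAt (fun z : E n × E m => fun i : S => gradY h i z.1 z.2) (xb, yb) :=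
    continuousAt_pi.2 fun i => hg i
  filter_upwards [hcont.eventually hli.eventually, hU] with z hz hzU hzΩ
  refine ⟨hz, Submodule.eq_of_le_of_finrank_eq (Submodule.span_mono ?_) ?_⟩
  · rintro _ ⟨i, rfl⟩
    exact ⟨⟨i, hSJ i.2⟩, rfl⟩
  · have := hr z ⟨hzU, hzΩ, trivial⟩
    rw [famRank] at this
    rw [this, finrank_span_eq_card hz, Fintype.card_coe, hr0]

/-- The equality part is rewritten over the basis `S`, and Carathéodory leaves an independent family
`K' ∪ S` at `z`. By RCPLD (iii), `K'` and `S` are then not positively dependent at the base point,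
so the cone estimate applies. There are finitely many `K'`, hence one constant. -/
theorem RCPLD.exists_bounded_multipliers {n m p ℓ : ℕ} {h : Fin p → E n → E m → EReal}
    {Ω : Set (E n)} {xb : E n} {yb : E m} (hxb : xb ∈ Ω)
    (hg : ∀ i, ContinuousAt (fun z : E n × E m => gradY h i z.1 z.2) (xb, yb))
    (hrcpld : RCPLD ℓ h Ω xb yb) :
    ∃ C : ℝ, 0 < C ∧ ∀ᶠ z in 𝓝 (xb, yb), z.1 ∈ Ω → ∀ c : Fin p → ℝ,
      (∀ i ∈ ineqIdx p ℓ, 0 ≤ c i) → (∀ i ∈ ineqIdx p ℓ, i ∉ activeIdx ℓ h xb yb → c i = 0) →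
      ∃ c' : Fin p → ℝ, (∀ i ∈ ineqIdx p ℓ, 0 ≤ c' i) ∧ (∀ i ∈ ineqIdx p ℓ, c i = 0 → c' i = 0) ∧
        ∑ i, c' i • gradY h i z.1 z.2 = ∑ i, c i • gradY h i z.1 z.2 ∧
        ‖c'‖ ≤ C * ‖∑ i, c i • gradY h i z.1 z.2‖ := by
  obtain ⟨U, hU, S, hSJ, ⟨hli, hspan⟩, ⟨r, hr⟩, hdep⟩ := hrcpld
  have hbound : ∀ K : Finset (Fin p), ∃ C : ℝ, 0 < C ∧ ∀ᶠ z in 𝓝 (xb, yb), z.1 ∈ Ω →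
      (∀ i ∈ K, i ∈ activeIdx ℓ h xb yb) →
      LinearIndependent ℝ (fun i : (K ∪ S : Finset (Fin p)) => gradY h i z.1 z.2) →
      ∀ c : Fin p → ℝ, (∀ i ∈ K, 0 ≤ c i) → (∀ i, i ∉ K ∪ S → c i = 0) →
        ‖c‖ ≤ C * ‖∑ i, c i • gradY h i z.1 z.2‖ := by
    intro K
    by_cases hK : (∀ i ∈ K, i ∈ activeIdx ℓ h xb yb) ∧
        ¬ PosLinDep (fun i : K => gradY h i xb yb) (fun i : S => gradY h i xb yb)
    · have hKS : Disjoint K S := Finset.disjoint_left.2 fun i hi hiS =>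
        mem_eqIdx_iff.1 (hSJ hiS) (hK.1 i hi).1
      set T : Set (Fin p → ℝ) := {c | (∀ i ∈ K, 0 ≤ c i) ∧ ∀ i, i ∉ K ∪ S → c i = 0} with hT
      have hTc : IsClosed T := by
        simp only [hT, Set.ofPred_and, Set.ofPred_forall]
        exact (isClosed_biInter fun i _ => isClosed_le continuous_const (continuous_apply i)).inter
          (isClosed_iInter fun i => isClosed_iInter fun _ =>
            isClosed_eq (continuous_apply i) continuous_const)
      obtain ⟨C, hC, hCz⟩ := eventually_norm_le_of_injOn_cone
        (fun (z : E n × E m) i => gradY h i z.1 z.2) (xb, yb) hg T hTc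
        (fun c hcT s hs => ⟨fun i hi => mul_nonneg hs.le (hcT.1 i hi),
          fun i hi => by simp [hcT.2 i hi]⟩)
        (fun c hcT hsum =>
          eq_zero_of_not_posLinDep (fun i => gradY h i xb yb) K S hKS hK.2 c hcT.1 hcT.2 hsum)
      exact ⟨C, hC, hCz.mono fun z hz _ _ _ c h1 h2 => hz c ⟨h1, h2⟩⟩
    -- The bound is vacuous here: either `K` has an inactive index, or RCPLD (iii) rules out the
    -- assumed independence.
    · refine ⟨1, one_pos, ?_⟩
      filter_upwards [hU] with z hz hzΩ hKA hKli
      exact absurd hKli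
        (hdep K hKA (not_not.1 fun hnot => hK ⟨hKA, hnot⟩) z ⟨hz, hzΩ, trivial⟩)
  choose C hC hCz using hbound
  refine ⟨∑ K, C K, Finset.sum_pos (fun K _ => hC K) Finset.univ_nonempty, ?_⟩
  filter_upwards [Filter.eventually_all.2 hCz,
    RCPLD.eventually_span_eq hxb hg hU hSJ hli hspan hr] with z hz hspanz hzΩ c hc hcA
  obtain ⟨hliz, hspanz⟩ := hspanz hzΩ
  have hmem : ∑ i ∈ eqIdx p ℓ, c i • gradY h i z.1 z.2 ∈
      Submodule.span ℝ (Set.range fun i : S => gradY h i z.1 z.2) := by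
    rw [hspanz]
    exact Submodule.sum_mem _ fun i hi => Submodule.smul_mem _ _ (Submodule.subset_span ⟨⟨i, hi⟩, rfl⟩)
  obtain ⟨b, hb⟩ := (Submodule.mem_span_range_iff_exists_fun ℝ).1 hmem
  -- Starting from the support of `c` ensures that no new inequality acquires a weight.
  set K := (ineqIdx p ℓ).filter fun i => c i ≠ 0 with hKdef
  have hIS : ∀ i ∈ ineqIdx p ℓ, i ∉ S := fun i hi hiS => mem_eqIdx_iff.1 (hSJ hiS) hi
  have hKS : Disjoint K S := Finset.disjoint_left.2 fun i hi => hIS i (Finset.mem_filter.1 hi).1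
  set c₁ : Fin p → ℝ := fun i => if i ∈ ineqIdx p ℓ then c i else if hi : i ∈ S then b ⟨i, hi⟩ else 0
    with hc₁
  have hsplit : ∀ w : Fin p → E m, ∑ i, w i = ∑ i ∈ ineqIdx p ℓ, w i + ∑ i ∈ eqIdx p ℓ, w i := by
    intro w
    have : eqIdx p ℓ = (ineqIdx p ℓ)ᶜ := by
      ext i
      rw [Finset.mem_compl, mem_eqIdx_iff]
    rw [this, Finset.sum_add_sum_compl]
  have hsum₁ : ∑ i, c₁ i • gradY h i z.1 z.2 = ∑ i, c i • gradY h i z.1 z.2 := by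
    rw [hsplit, hsplit fun i => c i • gradY h i z.1 z.2, ← hb,
      ← Finset.sum_subset hSJ fun i hi hiS => by
        simp only [hc₁, if_neg (mem_eqIdx_iff.1 hi), dif_neg hiS, zero_smul],
      ← Finset.sum_coe_sort S]
    congr 1
    · exact Finset.sum_congr rfl fun i hi => by simp only [hc₁, if_pos hi]
    · refine Finset.sum_congr rfl fun i _ => ?_
      simp only [hc₁, if_neg (mem_eqIdx_iff.1 (hSJ i.2)), dif_pos i.2]
  obtain ⟨K', hK', c', h1, h2, h3, h4⟩ := exists_linearIndepOn_nonneg_combination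
    (fun i => gradY h i z.1 z.2) S hliz K hKS c₁
    (fun i hi => by
      have hiI := (Finset.mem_filter.1 hi).1
      simpa only [hc₁, if_pos hiI] using hc i hiI)
    (fun i hi => by
      rw [Finset.mem_union, not_or] at hi
      by_cases hiI : i ∈ ineqIdx p ℓ
      · simp only [hc₁, if_pos hiI]
        by_contra hne
        exact hi.1 (Finset.mem_filter.2 ⟨hiI, hne⟩)
      · simp only [hc₁, if_neg hiI, dif_neg hi.2])
  have hz' : ∀ i ∈ ineqIdx p ℓ, i ∉ K' → c' i = 0 := fun i hi hiK => h2 i (by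
    rw [Finset.mem_union, not_or]
    exact ⟨hiK, hIS i hi⟩)
  refine ⟨c', fun i hi => ?_, fun i hi hi0 => hz' i hi fun hiK => ?_, h3.trans hsum₁, ?_⟩
  · by_cases hiK : i ∈ K'
    · exact h1 i hiK
    · exact (hz' i hi hiK).ge
  · exact (Finset.mem_filter.1 (hK' hiK)).2 hi0
  · have := hz K' hzΩ (fun i hi => ?_) h4 c' h1 h2
    · rw [h3, hsum₁] at this
      exact this.trans (mul_le_mul_of_nonneg_right
        (Finset.single_le_sum (fun K _ => (hC K).le) (Finset.mem_univ K')) (norm_nonneg _))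
    · have hi' := Finset.mem_filter.1 (hK' hi)
      by_contra hiA
      exact hi'.2 (hcA i hi'.1 hiA)

/-! ### Passage from the hypotheses to local estimates -/

theorem InnerSemicontinuousAt.eventually_exists {n m : ℕ} {Υ : E n → Set (E m)} {Ω : Set (E n)}
    {xb : E n} {yb : E m} (hisc : InnerSemicontinuousAt Υ Ω xb yb) {ρ : ℝ} (hρ : 0 < ρ) :
    ∀ᶠ x in 𝓝 xb, x ∈ Ω → ∃ y ∈ Υ x, dist y yb < ρ := by
  by_contra hcon
  obtain ⟨x, hx, hxP⟩ := Filter.exists_seq_forall_of_frequently (Filter.not_eventually.1 hcon)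
  push Not at hxP
  obtain ⟨y, hy, hyx⟩ := hisc.2 x (fun k => (hxP k).1) hx
  obtain ⟨k, hk, hk'⟩ := (hyx.and (Metric.tendsto_nhds.1 hy ρ hρ)).exists
  exact absurd hk' (not_lt.2 ((hxP k).2 _ hk))

theorem SmoothOn.hasGradientAt {n m p : ℕ} {h : Fin p → E n → E m → EReal} {W : Set (E n × E m)}
    (hs : SmoothOn h W) (i : Fin p) {z : E n × E m} (hz : z ∈ W) :
    HasGradientAt (fun y => (h i z.1 y).toReal) (gradY h i z.1 z.2) z.2 :=
  ((hs i).2.2.1 z hz).hasGradientAt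

/-- Uniform first-order approximation on a ball on which the gradients vary little. -/
theorem abs_sub_sub_inner_le_of_norm_gradient_sub_le {V : Type*} [NormedAddCommGroup V]
    [InnerProductSpace ℝ V] [CompleteSpace V] {f : V → ℝ} {g : V → V} {B : Set V}
    (hB : Convex ℝ B) (hf : ∀ u ∈ B, HasGradientAt f (g u) u) {ε : ℝ} {u y : V} (hu : u ∈ B)
    (hy : y ∈ B) (hg : ∀ w ∈ B, ‖g w - g u‖ ≤ ε) :
    |f y - f u - inner ℝ (g u) (y - u)| ≤ ε * ‖y - u‖ := by
  have := hB.norm_image_sub_le_of_norm_hasFDerivWithin_le' (f := f)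
    (f' := fun w => innerSL ℝ (g w)) (φ := innerSL ℝ (g u)) (C := ε)
    (fun w hw => ((hf w hw).hasFDerivAt : HasFDerivAt f (innerSL ℝ (g w)) w).hasFDerivWithinAt)
    (fun w hw => by rw [← map_sub, innerSL_apply_norm]; exact hg w hw) hu hy
  simpa using this

theorem le_violation {n m p ℓ : ℕ} (h : Fin p → E n → E m → EReal) (x : E n) (y : E m) :
    0 ≤ violation ℓ h x y ∧ (∀ i ∈ ineqIdx p ℓ, h i x y ≤ violation ℓ h x y) ∧
      ∀ i ∈ eqIdx p ℓ, ((h i x y).abs : EReal) ≤ violation ℓ h x y := by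
  refine ⟨le_max_left _ _, fun i hi => ?_, fun i hi => ?_⟩
  · exact (le_iSup₂_of_le (f := fun i (_ : i ∈ ineqIdx p ℓ) => h i x y) i hi le_rfl).trans
      ((le_max_left _ _).trans (le_max_right _ _))
  · exact (le_iSup₂_of_le (f := fun i (_ : i ∈ eqIdx p ℓ) => ((h i x y).abs : EReal))
      i hi le_rfl).trans ((le_max_right _ _).trans (le_max_right _ _))

theorem infEDist_le_mul_violation {n m p ℓ : ℕ} {h : Fin p → E n → E m → EReal} {F : Set (E m)}
    (hF : F.Nonempty) {x : E n} {y : E m} (hfin : ∀ i, h i x y ≠ ⊤ ∧ h i x y ≠ ⊥) {κ : ℝ}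
    (hκ : 0 < κ)
    (hle : ∀ t : ℝ, 0 ≤ t → (∀ i ∈ ineqIdx p ℓ, (h i x y).toReal ≤ t) →
      (∀ i ∉ ineqIdx p ℓ, |(h i x y).toReal| ≤ t) → Metric.infDist y F ≤ κ * t) :
    ((Metric.infEDist y F : ENNReal) : EReal) ≤ (κ : EReal) * violation ℓ h x y := by
  obtain ⟨h0, hI, hJ⟩ := le_violation (ℓ := ℓ) h x y
  have hcoe : ∀ i, h i x y = ((h i x y).toReal : EReal) := fun i =>
    (EReal.coe_toReal (hfin i).1 (hfin i).2).symm
  generalize violation ℓ h x y = s at h0 hI hJ ⊢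
  induction s with
  | bot => simp at h0
  | top => rw [EReal.coe_mul_top_of_pos hκ]; exact le_top
  | coe t =>
    have hle' := hle t (by exact_mod_cast h0)
      (fun i hi => by
        have := hI i hi
        rw [hcoe i] at this
        exact_mod_cast this)
      (fun i hi => by
        have := hJ i (mem_eqIdx_iff.2 hi)
        rw [hcoe i, EReal.coe_abs] at this
        exact_mod_cast this)
    rw [← ENNReal.ofReal_toReal (Metric.infEDist_ne_top hF), EReal.coe_ennreal_ofReal,
      max_eq_left ENNReal.toReal_nonneg, ← EReal.coe_mul]
    exact_mod_cast hle'

end ParamSystem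

/-! ### Choice of neighborhoods and conclusion -/

theorem mainTheorem2 {n m p ℓ : ℕ} (hℓ : ℓ ≤ p)
    (h : Fin p → ParamSystem.E n → ParamSystem.E m → EReal)
    (xb : ParamSystem.E n) (yb : ParamSystem.E m)
    (hmem : yb ∈ ParamSystem.feas ℓ h xb)
    (hsmooth : ∃ W : Set (ParamSystem.E n × ParamSystem.E m), IsOpen W ∧
      {xb} ×ˢ ParamSystem.feas ℓ h xb ⊆ W ∧ ParamSystem.SmoothOn h W)
    (hcont : ∀ x ∈ ParamSystem.dom (ParamSystem.feas ℓ h), ∀ i : Fin p,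
      (∀ y, h i x y ≠ ⊤ ∧ h i x y ≠ ⊥) ∧ Continuous (h i x))
    (hisc : ParamSystem.InnerSemicontinuousAt (ParamSystem.feas ℓ h)
      (ParamSystem.dom (ParamSystem.feas ℓ h)) xb yb)
    (hrcpld : ParamSystem.RCPLD ℓ h (ParamSystem.dom (ParamSystem.feas ℓ h)) xb yb) :
    ParamSystem.RRegularAt ℓ h (ParamSystem.dom (ParamSystem.feas ℓ h)) xb yb := by
  obtain ⟨W, hWo, hWsub, hW⟩ := hsmooth
  have hz₀W : (xb, yb) ∈ W := hWsub ⟨rfl, hmem⟩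
  have hWn : W ∈ 𝓝 (xb, yb) := hWo.mem_nhds hz₀W
  have hg : ∀ i, ContinuousAt
      (fun z : ParamSystem.E n × ParamSystem.E m => ParamSystem.gradY h i z.1 z.2) (xb, yb) :=
    fun i => (hW i).2.2.2.continuousAt hWn
  obtain ⟨C, hC, hCz⟩ := hrcpld.exists_bounded_multipliers
    (show xb ∈ ParamSystem.dom (ParamSystem.feas ℓ h) from ⟨yb, hmem⟩) hg
  have hκ : 0 < 2 * ((p : ℝ) + 1) * C := by positivity
  -- Chosen so that `p * C * ε ≤ 1 / 2`; using `p + 1` keeps the constants positive when `p = 0`.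
  set ε : ℝ := 1 / (2 * ((p : ℝ) + 1) * C) with hε
  have hε0 : 0 < ε := by positivity
  have hgε : ∀ᶠ z in 𝓝 (xb, yb), ∀ i,
      ‖ParamSystem.gradY h i z.1 z.2 - ParamSystem.gradY h i xb yb‖ < ε / 2 :=
    Filter.eventually_all.2 fun i => by
      simpa [dist_eq_norm] using Metric.tendsto_nhds.1 (hg i) (ε / 2) (by positivity)
  -- Inequalities inactive at the base point stay strictly negative nearby, so only active ones can
  -- receive penalty weight.
  have hinact : ∀ᶠ z in 𝓝 (xb, yb), ∀ i ∈ ParamSystem.ineqIdx p ℓ,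
      i ∉ ParamSystem.activeIdx ℓ h xb yb → h i z.1 z.2 < 0 := by
    refine Filter.eventually_all.2 fun i => ?_
    by_cases hi : i ∈ ParamSystem.ineqIdx p ℓ ∧ i ∉ ParamSystem.activeIdx ℓ h xb yb
    · have hlt : h i xb yb < 0 := lt_of_le_of_ne (hmem.1 i hi.1) fun h0 => hi.2 ⟨hi.1, h0⟩
      exact (((hW i).2.1.continuousAt hWn).eventually_lt continuousAt_const hlt).mono
        fun z hz _ _ => hz
    · exact Filter.Eventually.of_forall fun z h1 h2 => absurd ⟨h1, h2⟩ hi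
  obtain ⟨ρ, hρ, hball⟩ := Metric.eventually_nhds_iff_ball.1
    ((hCz.and (hgε.and hinact)).and (hWo.eventually_mem hz₀W))
  -- With `y` and `w` both within `ρ / 4` of `yb`, `w` lies in the open ball of radius `ρ / 2`
  -- around `y`, and the closed one stays inside `ball yb ρ`.
  have hnear : ∀ᶠ z in 𝓝 (xb, yb), z.1 ∈ Metric.ball xb ρ ∧ z.2 ∈ Metric.ball yb (ρ / 4) ∧
      (z.1 ∈ ParamSystem.dom (ParamSystem.feas ℓ h) →
        ∃ w ∈ ParamSystem.feas ℓ h z.1, dist w yb < ρ / 4) := by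
    have hfst : Filter.Tendsto Prod.fst (𝓝 (xb, yb)) (𝓝 xb) := continuousAt_fst
    have hsnd : Filter.Tendsto Prod.snd (𝓝 (xb, yb)) (𝓝 yb) := continuousAt_snd
    exact (hfst.eventually (Metric.ball_mem_nhds xb hρ)).and
      ((hsnd.eventually (Metric.ball_mem_nhds yb (by positivity))).and
        (hfst.eventually (hisc.eventually_exists (by positivity))))
  refine ⟨hmem, 2 * ((p : ℝ) + 1) * C, hκ, _, hnear, ?_⟩
  rintro ⟨x, y⟩ ⟨⟨hx, hy, hw⟩, hxΩ, -⟩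
  obtain ⟨w, hwF, hwd⟩ := hw hxΩ
  dsimp only at hx hy hwF hxΩ ⊢
  have hB : ∀ u ∈ Metric.ball yb ρ, (x, u) ∈ Metric.ball (xb, yb) ρ := fun u hu => by
    rw [Metric.mem_ball, Prod.dist_eq]
    exact max_lt hx hu
  have hfin : ∀ u ∈ Metric.ball yb ρ, ∀ i, h i x u = ((h i x u).toReal : EReal) := fun u hu i =>
    have := (hW i).1 (x, u) (hball _ (hB u hu)).2
    (EReal.coe_toReal this.1 this.2).symm
  rw [Metric.mem_ball] at hy
  have hyB : y ∈ Metric.ball yb ρ := Metric.mem_ball.2 (by linarith)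
  have hwB : w ∈ Metric.ball yb ρ := Metric.mem_ball.2 (by linarith)
  refine ParamSystem.infEDist_le_mul_violation ⟨w, hwF⟩
    (fun i => (hW i).1 (x, y) (hball _ (hB y hyB)).2) hκ fun t ht htI htJ => ?_
  have hgrad : ∀ i, ∀ u ∈ Metric.ball yb ρ, HasGradientAt (fun u => (h i x u).toReal)
      (ParamSystem.gradY h i x u) u := fun i u hu => hW.hasGradientAt i (hball _ (hB u hu)).2
  have hmain := ParamSystem.infDist_le_of_bounded_multipliers
    (fun i u => (h i x u).toReal) (fun i u => ParamSystem.gradY h i x u) (ParamSystem.ineqIdx p ℓ)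
    (ParamSystem.feas ℓ h x) (Metric.ball yb ρ) ε C t (ρ / 2) y w ?_ hgrad ?_ ?_ hε0.le hC.le ?_
    ht htI htJ ?_ ?_ hwF ?_ ?_
  · refine hmain.trans (mul_le_mul_of_nonneg_right ?_ ht)
    rw [Fintype.card_fin]
    nlinarith
  · refine fun u hu hI hJ => ⟨fun i hi => ?_, fun i hi => ?_⟩
    · rw [hfin u hu i]
      exact_mod_cast hI i hi
    · rw [hfin u hu i]
      exact_mod_cast hJ i (ParamSystem.mem_eqIdx_iff.1 hi)
  · refine fun i u hu => ParamSystem.abs_sub_sub_inner_le_of_norm_gradient_sub_le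
      (convex_ball yb ρ) (hgrad i) hu hyB fun v hv => ?_
    have h1 := (hball _ (hB u hu)).1.2.1 i
    have h2 := (hball _ (hB v hv)).1.2.1 i
    have h3 := norm_sub_le_norm_sub_add_norm_sub (ParamSystem.gradY h i x v)
      (ParamSystem.gradY h i xb yb) (ParamSystem.gradY h i x u)
    rw [norm_sub_rev (ParamSystem.gradY h i xb yb)] at h3
    dsimp only at h1 h2
    linarith
  · intro u hu c hc hc0
    obtain ⟨c', h1, h2, h3, h4⟩ := (hball _ (hB u hu)).1.1 hxΩ c hc fun i hi hiA => hc0 i hi (by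
      have := (hball _ (hB u hu)).1.2.2 i hi hiA
      dsimp only at this
      rw [hfin u hu i] at this
      exact (by exact_mod_cast this : (h i x u).toReal < 0).le)
    exact ⟨c', h1, fun i hi hi0 => h2 i hi (hc0 i hi hi0), h3, h4⟩
  · rw [Fintype.card_fin, hε]
    field_simp
    linarith
  · exact fun u hu => Metric.mem_ball.2 (by
      have := dist_triangle u y yb
      have := Metric.mem_closedBall.1 hu
      linarith)
  · have := dist_triangle_right w y yb
    linarith
  · intro i hi
    have := hwF.1 i hi
    rw [hfin w hwB i] at this
    exact_mod_cast this
  · intro i hi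
    have := hwF.2 i (ParamSystem.mem_eqIdx_iff.2 hi)
    rw [hfin w hwB i] at this
    exact_mod_cast this
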